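/- Conventions. For subsets $X,Y$ of a group $G$ write $X\cdot Y=\{xy : x\in X, y\in Y\}$, let an empty product of sets be $\{1\}$, and write $[x,y]=xyx^{-1}y^{-1}$. Let $l\ge 0$ and $r_1,\dots,r_l\ge 0$ be integers and let $G$ be a group. For each $1\le i\le l$ let $H_{i,0}$ be a finite abelian group (written additively), and for $1\le j\le r_i$ let $H_{i,j}=\{-N_{i,j},\dots,N_{i,j}\}\subset\mathbb Z$ with $N_{i,j}\ge 0$ an integer. Suppose that maps $\phi_{i,j}:H_{i,j}\to G$ ($1\le i\le l$, $0\le j\le r_i$) are given and put $$A_i=\phi_{i,0}(H_{i,0})\cdot\ldots\cdot\phi_{i,r_i}(H_{i,r_i}),\qquad A_{\ge i}=A_l\cdot A_{l-1}\cdot\ldots\cdot A_i,\qquad A_{\ge l+1}=\{1\}.$$ Then $A=A_{\ge 1}$ is called a coset nilprogression in $G$ of derived length $l$ and ranks $r_1,\dots,r_l$ if 1. $\phi_{i,j}(0)=1$ for all $1\le i\le l$ and $0\le j\le r_i$; 2. $\phi_{i,j}(n)\phi_{i,j}(n')\in A_{\ge i+1}\cdot\phi_{i,j}(n+n')$ whenever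 $1\le i\le l$, $0\le j\le r_i$ and $n,n',n+n'\in H_{i,j}$; 3. $[\phi_{i,j}(n),\phi_{i,j'}(n')]\in A_{\ge i+1}$ whenever $1\le i\le l$, $0\le j,j'\le r_i$, $n\in H_{i,j}$ and $n'\in H_{i,j'}$; 4. $[\phi_{i',j'}(n'),\phi_{i,j}(n)]\in A_{\ge i+1}\cdot\phi_{i,0}(H_{i,0})\cdot\ldots\cdot\phi_{i,\max(j-1,0)}(H_{i,\max(j-1,0)})$ whenever $1\le i'<i\le l$, $0\le j\le r_i$, $0\le j'\le r_{i'}$, $n\in H_{i,j}$ and $n'\in H_{i',j'}$. It is called a nilprogression if moreover all the groups $H_{i,0}$ and maps $\phi_{i,0}$ are trivial. Lemma (virtual nilpotency of nilprogressions). For all integers $l\ge 0$ and $r_1,\dots,r_l\ge 0$ there is a constant $C$, depending only on $l,r_1,\dots,r_l$, such that the following holds for every group $G$ and every coset nilprogression $A$ in $G$ of derived length $l$ and ranks $r_1,\dots,r_l$. The group $\langle A\rangle$ generated by $A$ contains a subgroup $N$ of finite index at most $C|A|^{C}$ in $\langle A\rangle$ which is nilpotent of step at most $C$ and is generated by at most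 $C$ elements. If $A$ is a nilprogression, then $\langle A\rangle$ itself is nilpotent of step at most $C$ and is generated by at most $C$ elements. -/

import Mathlib

open scoped Pointwise commutatorElement

universe u v

/-- The raw data of a coset nilprogression in `G` of derived length `l` and ranks `r`.
Levels are indexed by `i : Fin l`, starting from `0`.
At level `i` there are a finite abelian group `H i` (the group `H_{i,0}`) with a map
`cosetMap i` into `G`, and for each `j : Fin (r i)` an interval `{-N i j, …, N i j}` with a map
`intervalMap i j` into `G`; only the values of `intervalMap i j` on the interval are ever used. -/
structure CosetNilData (G : Type u) [Group G] (l : ℕ) (r : Fin l → ℕ) where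
  H : Fin l → Type v
  [addCommGroup : ∀ i, AddCommGroup (H i)]
  [finite : ∀ i, Finite (H i)]
  N : ∀ i, Fin (r i) → ℕ
  cosetMap : ∀ i, H i → G
  intervalMap : ∀ i, Fin (r i) → ℤ → G

attribute [instance] CosetNilData.addCommGroup CosetNilData.finite

namespace CosetNilData

variable {G : Type u} [Group G] {l : ℕ} {r : Fin l → ℕ}

/-- The interval `{-N, …, N}` of integers that serves as `H_{i,j}` for `j ≥ 1`. -/
def interval (D : CosetNilData.{u, v} G l r) (i : Fin l) (j : Fin (r i)) : Set ℤ :=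
  Set.Icc (-(D.N i j : ℤ)) (D.N i j : ℤ)

/-- The image `φ_{i,j}(H_{i,j})`, for `0 ≤ j ≤ r i`: the index `0` is the finite group, the
index `j + 1` is the interval number `j`. -/
def block (D : CosetNilData.{u, v} G l r) (i : Fin l) : Fin (r i + 1) → Set G :=
  Fin.cons (Set.range (D.cosetMap i)) (fun j => D.intervalMap i j '' D.interval i j)

/-- The product set of the first `k` blocks of level `i`,
`φ_{i,0}(H_{i,0}) ⋯ φ_{i,k-1}(H_{i,k-1})`. -/
def partialLevel (D : CosetNilData.{u, v} G l r) (i : Fin l) (k : ℕ) : Set G :=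
  ((List.ofFn (D.block i)).take k).prod

/-- The product set `A_i = φ_{i,0}(H_{i,0}) ⋯ φ_{i,r_i}(H_{i,r_i})`. -/
def level (D : CosetNilData.{u, v} G l r) (i : Fin l) : Set G :=
  (List.ofFn (D.block i)).prod

/-- The product set of all levels of index at least `k`, the last level coming first;
it is `{1}` if there are no such levels. -/
def levelsFrom (D : CosetNilData.{u, v} G l r) (k : ℕ) : Set G :=
  ((List.ofFn D.level).drop k).reverse.prod

end CosetNilData

/-- A coset nilprogression in `G` of derived length `l` and ranks `r`.
Commutators are `⁅x, y⁆ = x * y * x⁻¹ * y⁻¹`. -/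
structure CosetNilprogression (G : Type u) [Group G] (l : ℕ) (r : Fin l → ℕ) extends
    CosetNilData.{u, v} G l r where
  cosetMap_zero : ∀ i, cosetMap i 0 = 1
  intervalMap_zero : ∀ i j, intervalMap i j 0 = 1
  cosetMap_mul : ∀ (i : Fin l) (n n' : H i),
    cosetMap i n * cosetMap i n' ∈
      toCosetNilData.levelsFrom (i + 1) * {cosetMap i (n + n')}
  intervalMap_mul : ∀ (i : Fin l) (j : Fin (r i)),
    ∀ n ∈ toCosetNilData.interval i j, ∀ n' ∈ toCosetNilData.interval i j,
      n + n' ∈ toCosetNilData.interval i j →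
        intervalMap i j n * intervalMap i j n' ∈
          toCosetNilData.levelsFrom (i + 1) * {intervalMap i j (n + n')}
  commutator_same_level : ∀ (i : Fin l) (j j' : Fin (r i + 1)),
    ∀ x ∈ toCosetNilData.block i j, ∀ y ∈ toCosetNilData.block i j',
      ⁅x, y⁆ ∈ toCosetNilData.levelsFrom (i + 1)
  /-- The blocks allowed on the right are those of index `0, …, max (j - 1) 0`. -/
  commutator_lower_level : ∀ (i' i : Fin l), i' < i →
    ∀ (j : Fin (r i + 1)) (j' : Fin (r i' + 1)),
      ∀ x ∈ toCosetNilData.block i' j', ∀ y ∈ toCosetNilData.block i j,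
        ⁅x, y⁆ ∈ toCosetNilData.levelsFrom (i + 1) *
          toCosetNilData.partialLevel i (((j : ℕ) - 1) + 1)

namespace CosetNilprogression

variable {G : Type u} [Group G] {l : ℕ} {r : Fin l → ℕ}

/-- The underlying set `A = A_l ⋯ A_1` of a coset nilprogression. -/
def carrier (P : CosetNilprogression.{u, v} G l r) : Set G :=
  P.toCosetNilData.levelsFrom 0

/-- A nilprogression is a coset nilprogression all of whose finite groups (and the maps on them)
are trivial. -/
def IsNilprogression (P : CosetNilprogression.{u, v} G l r) : Prop :=
  ∀ i, Subsingleton (P.H i) ∧ ∀ h : P.H i, P.cosetMap i h = 1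

end CosetNilprogression

/-- `K` is nilpotent of step at most `s`. -/
def IsNilpotentOfStepLE (K : Type u) [Group K] (s : ℕ) : Prop :=
  Group.IsNilpotent K ∧ Group.nilpotencyClass K ≤ s

/-- `K` is generated by at most `k` elements. -/
def IsGeneratedByLE (K : Type u) [Group K] (k : ℕ) : Prop :=
  ∃ S : Finset K, S.card ≤ k ∧ Subgroup.closure (S : Set K) = ⊤

/-! The blocks generate a descending chain of subgroups `stage i k` from ⟨A⟩ to 1, each normal in
⟨A⟩. Within a level, removing an interval block leaves a factor that is cyclic, generated by
`φ_{i,j}(1)`, and central by the commutator conditions. Removing the finite block leaves a factor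
represented by `φ_{i,0}(H_{i,0})`, hence of order at most |A|. The quotients of ⟨A⟩ are then built
up along this chain. A central cyclic extension lengthens the series and keeps the index. A finite
kernel of order M is absorbed by `HasCyclicCentralSeries.exists_subgroup_of_finite_ker`: repeatedly
passing to centralizers of lifted generators costs a bounded power of M in the index. Only levels
cost index, so the total is polynomial in |A|. For a nilprogression M = 1, and nothing is lost.
Cyclic factors are tracked because the length of such a series bounds both the step and the number
of generators, and subgroups inherit it. -/

/-- `G` has a central series of length `k` with cyclic factors. -/
def HasCyclicCentralSeries : ℕ → ∀ (G : Type u) [Group G], Prop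
  | 0, G, _ => Subsingleton G
  | k + 1, G, _ => ∃ (Q : Type u) (_ : Group Q) (f : G →* Q),
      f.ker ≤ Subgroup.center G ∧ IsCyclic f.ker ∧ HasCyclicCentralSeries k Q

/-! ### Central series with cyclic factors -/

namespace HasCyclicCentralSeries

/-- The maps in a series need not be surjective, so restricting the first one keeps the same `Q`. -/
theorem of_injective {k : ℕ} {G H : Type u} [Group G] [Group H]
    (hG : HasCyclicCentralSeries k G) (f : H →* G) (hf : Function.Injective f) :
    HasCyclicCentralSeries k H := by
  cases k with
  | zero =>
    have : Subsingleton G := hG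
    exact hf.subsingleton
  | succ k =>
    obtain ⟨Q, _, g, hc, hcyc, hQ⟩ := hG
    refine ⟨Q, _, g.comp f, fun x hx => ?_, ?_, hQ⟩
    · rw [Subgroup.mem_center_iff]
      intro y
      have hx' : f x ∈ Subgroup.center G := hc hx
      rw [Subgroup.mem_center_iff] at hx'
      exact hf (by simpa using hx' (f y))
    · let φ : (g.comp f).ker →* g.ker :=
        (f.comp (g.comp f).ker.subtype).codRestrict g.ker (fun x => x.2)
      refine isCyclic_of_injective φ fun x y hxy => ?_
      exact Subtype.ext (hf (congrArg Subtype.val hxy))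

theorem subgroup {k : ℕ} {G : Type u} [Group G]
    (hG : HasCyclicCentralSeries k G) (H : Subgroup G) : HasCyclicCentralSeries k H :=
  hG.of_injective H.subtype H.subtype_injective

theorem succ {k : ℕ} {G : Type u} [Group G] (hG : HasCyclicCentralSeries k G) :
    HasCyclicCentralSeries (k + 1) G := by
  have hker : (MonoidHom.id G).ker = ⊥ := (MonoidHom.ker_eq_bot_iff _).2 Function.injective_id
  refine ⟨G, _, MonoidHom.id G, by simp [hker], ?_, hG⟩
  rw [hker]
  infer_instance

theorem mono {k m : ℕ} (hkm : k ≤ m) {G : Type u} [Group G]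
    (hG : HasCyclicCentralSeries k G) : HasCyclicCentralSeries m G := by
  induction hkm with
  | refl => exact hG
  | step _ ih => exact ih.succ

theorem isNilpotentOfStepLE {k : ℕ} {G : Type u} [Group G] (hG : HasCyclicCentralSeries k G) :
    IsNilpotentOfStepLE G k := by
  induction k generalizing G with
  | zero =>
    have : Subsingleton G := hG
    exact ⟨inferInstance, (Group.nilpotencyClass_zero_iff_subsingleton.2 this).le⟩
  | succ k ih =>
    obtain ⟨Q, _, g, hc, -, hQ⟩ := hG
    obtain ⟨hn, hle⟩ := ih hQ
    exact ⟨Subgroup.isNilpotent_of_ker_le_center g hc,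
      (Group.nilpotencyClass_le_of_ker_le_center g hc).trans (by omega)⟩

/-- A generator of the kernel and lifts of generators of the range suffice; the range inherits the
series of `Q`. -/
theorem isGeneratedByLE {k : ℕ} {G : Type u} [Group G] (hG : HasCyclicCentralSeries k G) :
    IsGeneratedByLE G k := by
  classical
  induction k generalizing G with
  | zero =>
    have : Subsingleton G := hG
    exact ⟨∅, by simp, Subsingleton.elim _ _⟩
  | succ k ih =>
    obtain ⟨Q, _, g, -, hcyc, hQ⟩ := hG
    obtain ⟨S, hS, hgen⟩ := ih (hQ.subgroup g.range)
    obtain ⟨z, hz⟩ := (Subgroup.isCyclic_iff_exists_zpowers_eq_top _).1 hcyc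
    choose lift hlift using g.rangeRestrict_surjective
    refine ⟨insert z (S.image lift), ?_, ?_⟩
    · exact (Finset.card_insert_le _ _).trans
        (Nat.succ_le_succ (Finset.card_image_le.trans hS))
    · set T := Subgroup.closure ((insert z (S.image lift) : Finset G) : Set G) with hT
      have hzT : g.ker ≤ T := by
        rw [← hz, Subgroup.zpowers_le]
        exact Subgroup.subset_closure (by simp)
      have hmap : T.map g.rangeRestrict = ⊤ := by
        rw [eq_top_iff, ← hgen, Subgroup.closure_le]
        intro s hs
        refine ⟨lift s, Subgroup.subset_closure ?_, hlift s⟩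
        rw [Finset.coe_insert, Finset.coe_image]
        exact Or.inr ⟨s, hs, rfl⟩
      rw [eq_top_iff]
      intro x _
      obtain ⟨t, ht, htx⟩ : g.rangeRestrict x ∈ T.map g.rangeRestrict := hmap ▸ Subgroup.mem_top _
      have hmem : t⁻¹ * x ∈ g.ker := by
        have : g t = g x := congrArg Subtype.val htx
        simp [MonoidHom.mem_ker, this]
      simpa using T.mul_mem ht (hzT hmem)

end HasCyclicCentralSeries

/-! ### Extensions by finite kernels -/

/-- If `f z` commutes with the image of `f`, then the centralizer of `z` has index at most the
order of the kernel of `f`. -/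
theorem index_centralizer_le_card_ker {E Q : Type*} [Group E] [Group Q] (f : E →* Q)
    [Finite f.ker] (z : E) (hz : ∀ e, Commute (f e) (f z)) :
    (Subgroup.centralizer {z}).index ≠ 0 ∧
      (Subgroup.centralizer {z}).index ≤ Nat.card f.ker := by
  -- The commutator with `z` takes values in the kernel and separates the left cosets of the
  -- centralizer.
  let φ : E → f.ker := fun e => ⟨e * z * e⁻¹ * z⁻¹, by
    simp [MonoidHom.mem_ker, (hz e).eq]⟩
  have hφ : ∀ a b, φ a = φ b → a⁻¹ * b ∈ Subgroup.centralizer {z} := by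
    intro a b hab
    have h : a * z * a⁻¹ = b * z * b⁻¹ := mul_right_cancel (congrArg Subtype.val hab)
    rw [Subgroup.mem_centralizer_singleton_iff]
    calc a⁻¹ * b * z = a⁻¹ * (b * z * b⁻¹) * b := by group
      _ = a⁻¹ * (a * z * a⁻¹) * b := by rw [h]
      _ = z * (a⁻¹ * b) := by group
  let ψ : E ⧸ Subgroup.centralizer {z} → f.ker := fun q => φ q.out
  have hψ : Function.Injective ψ := by
    intro p q hpq
    rw [← QuotientGroup.out_eq' p, ← QuotientGroup.out_eq' q]
    exact QuotientGroup.eq.2 (hφ _ _ hpq)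
  have : Finite (E ⧸ Subgroup.centralizer {z}) := Finite.of_injective ψ hψ
  exact ⟨Subgroup.FiniteIndex.index_ne_zero (H := Subgroup.centralizer {z})
    (self := Subgroup.finiteIndex_of_finite_quotient),
    Nat.card_le_card_of_injective ψ hψ⟩

/-- An extension of a group with a central series with `k` cyclic factors by a finite group of
order at most `M` has a subgroup with such a series, of index at most `M ^ (k + 1)`. -/
theorem HasCyclicCentralSeries.exists_subgroup_of_finite_ker {k M : ℕ} {E Q : Type u} [Group E]
    [Group Q] (hQ : HasCyclicCentralSeries k Q) (f : E →* Q) [Finite f.ker]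
    (hM : Nat.card f.ker ≤ M) :
    ∃ N : Subgroup E, HasCyclicCentralSeries k N ∧ N.index ≠ 0 ∧ N.index ≤ M ^ (k + 1) := by
  induction k generalizing E Q with
  | zero =>
    have : Subsingleton Q := hQ
    have htop : f.ker = ⊤ := by
      rw [eq_top_iff]
      exact fun x _ => Subsingleton.elim _ _
    have hcard : Nat.card f.ker = Nat.card E := by rw [htop, Subgroup.card_top]
    have hfin : Finite E := by
      have : Finite (⊤ : Subgroup E) := htop ▸ inferInstance
      exact Finite.of_equiv _ Subgroup.topEquiv.toEquiv
    refine ⟨⊥, (inferInstance : Subsingleton (⊥ : Subgroup E)), ?_, ?_⟩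
    · rw [Subgroup.index_bot]
      exact Nat.card_pos.ne'
    · rw [Subgroup.index_bot, ← hcard]
      simpa using hM
  | succ k ih =>
    obtain ⟨R, _, g, hc, hcyc, hR⟩ := hQ
    -- As `f` may not be surjective, `f z` generates the part of the cyclic group `g.ker` that lies
    -- in the image of `f`.
    obtain ⟨z, hzker, hz⟩ : ∃ z : E, g (f z) = 1 ∧
        ∀ e, g (f e) = 1 → ∃ n : ℤ, f e = f z ^ n := by
      let φ : (g.comp f).ker →* g.ker :=
        (f.comp (g.comp f).ker.subtype).codRestrict g.ker (fun x => x.2)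
      obtain ⟨⟨w, hw⟩⟩ : IsCyclic φ.range := inferInstance
      obtain ⟨⟨z, hz⟩, hzw⟩ := w.2
      refine ⟨z, hz, fun e he => ?_⟩
      obtain ⟨n, hn⟩ := hw ⟨φ ⟨e, he⟩, ⟨_, rfl⟩⟩
      refine ⟨n, ?_⟩
      have h1 : (w : g.ker) ^ n = φ ⟨e, he⟩ := congrArg Subtype.val hn
      rw [← hzw] at h1
      exact (congrArg Subtype.val h1).symm
    have hcomm : ∀ e, Commute (f e) (f z) := fun e =>
      Subgroup.mem_center_iff.1 (hc hzker) (f e)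
    obtain ⟨hi0, hi⟩ := index_centralizer_le_card_ker f z hcomm
    set E₁ := Subgroup.centralizer {z} with hE₁
    let z₁ : E₁ := ⟨z, Subgroup.mem_centralizer_singleton_iff.2 rfl⟩
    have hz₁ : Subgroup.zpowers z₁ ≤ Subgroup.center E₁ := by
      rw [Subgroup.zpowers_le, Subgroup.mem_center_iff]
      exact fun x => Subtype.ext (Subgroup.mem_centralizer_singleton_iff.1 x.2)
    have hnorm : (Subgroup.zpowers z₁).Normal := ⟨fun n hn g => by
      rwa [Subgroup.mem_center_iff.1 (hz₁ hn) g, mul_inv_cancel_right]⟩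
    let h : E₁ →* R := (g.comp f).comp E₁.subtype
    have hh : Subgroup.zpowers z₁ ≤ h.ker := by
      rw [Subgroup.zpowers_le]
      exact hzker
    let h₂ : E₁ ⧸ Subgroup.zpowers z₁ →* R := QuotientGroup.lift _ h hh
    -- If `f e = f z ^ n`, then `e * z ^ (-n)` lies in `f.ker` and represents the same coset. So the
    -- kernel over `R` is no larger than `f.ker`, and induction applies with the same `M`.
    have hker : ∀ x : h₂.ker, ∃ y : f.ker, ∃ e : E₁, (e : E) = y ∧
        (e : E₁ ⧸ Subgroup.zpowers z₁) = x := by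
      rintro ⟨x, hx⟩
      obtain ⟨e, rfl⟩ := QuotientGroup.mk_surjective x
      obtain ⟨n, hn⟩ := hz e hx
      refine ⟨⟨e * z ^ (-n), ?_⟩, e * z₁ ^ (-n), rfl, ?_⟩
      · simp [MonoidHom.mem_ker, hn]
      · rw [QuotientGroup.eq]
        exact ⟨n, by simp⟩
    choose y e hy he using hker
    have hinj : Function.Injective y := by
      intro a b hab
      apply Subtype.ext
      rw [← he a, ← he b, Subtype.ext ((hy a).trans ((congrArg Subtype.val hab).trans (hy b).symm))]
    have : Finite h₂.ker := Finite.of_injective y hinj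
    obtain ⟨N₂, hN₂, hN₂0, hN₂i⟩ := ih hR h₂ ((Nat.card_le_card_of_injective y hinj).trans hM)
    let N₁ : Subgroup E₁ := N₂.comap (QuotientGroup.mk' _)
    -- The new factor is `N₁ ∩ ⟨z⟩`, central because `E₁` centralizes `z`.
    have hN₁ : HasCyclicCentralSeries (k + 1) N₁ := by
      have hmem : ∀ x : N₁, x ∈ ((QuotientGroup.mk' (Subgroup.zpowers z₁)).subgroupComap N₂).ker →
          (x : E₁) ∈ Subgroup.zpowers z₁ := fun x hx =>
        (QuotientGroup.eq_one_iff _).1 (congrArg Subtype.val hx)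
      refine ⟨N₂, _, (QuotientGroup.mk' _).subgroupComap N₂, fun x hx => ?_, ?_, hN₂⟩
      · rw [Subgroup.mem_center_iff]
        exact fun a => Subtype.ext (Subgroup.mem_center_iff.1 (hz₁ (hmem x hx)) a)
      · let φ : ((QuotientGroup.mk' (Subgroup.zpowers z₁)).subgroupComap N₂).ker →*
            Subgroup.zpowers z₁ := (N₁.subtype.comp (Subgroup.subtype _)).codRestrict _
              (fun x => hmem x x.2)
        refine isCyclic_of_injective φ fun a b hab => ?_
        have h := congrArg Subtype.val hab
        exact Subtype.ext (Subtype.ext h)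
    have hidx : N₁.index = N₂.index :=
      Subgroup.index_comap_of_surjective _ (QuotientGroup.mk'_surjective _)
    refine ⟨N₁.map E₁.subtype, hN₁.of_injective
      (N₁.equivMapOfInjective _ E₁.subtype_injective).symm.toMonoidHom
      (MulEquiv.injective _), ?_, ?_⟩
    · rw [Subgroup.index_map_subtype, hidx]
      exact mul_ne_zero hN₂0 hi0
    · rw [Subgroup.index_map_subtype, hidx, pow_succ]
      exact Nat.mul_le_mul hN₂i (hi.trans hM)

/-! ### Virtual series under extensions -/

/-- `G` has a subgroup of finite index at most `b` with a central series with `k` cyclic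
factors. -/
def HasVirtualCyclicCentralSeries (k b : ℕ) (G : Type u) [Group G] : Prop :=
  ∃ N : Subgroup G, HasCyclicCentralSeries k N ∧ N.index ≠ 0 ∧ N.index ≤ b

namespace HasVirtualCyclicCentralSeries

theorem mono {k m b c : ℕ} (hkm : k ≤ m) (hbc : b ≤ c) {G : Type u} [Group G]
    (hG : HasVirtualCyclicCentralSeries k b G) : HasVirtualCyclicCentralSeries m c G := by
  obtain ⟨N, hN, h0, hi⟩ := hG
  exact ⟨N, hN.mono hkm, h0, hi.trans hbc⟩

theorem of_injective_surjective {k b : ℕ} {G H : Type u} [Group G] [Group H]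
    (hG : HasVirtualCyclicCentralSeries k b G) (f : H →* G) (hf : Function.Injective f)
    (hs : Function.Surjective f) : HasVirtualCyclicCentralSeries k b H := by
  obtain ⟨N, hN, h0, hi⟩ := hG
  rw [← Subgroup.index_comap_of_surjective N hs] at h0 hi
  refine ⟨N.comap f, hN.of_injective (f.subgroupComap N) fun x y hxy => ?_, h0, hi⟩
  exact Subtype.ext (hf (congrArg Subtype.val hxy))

theorem of_central_cyclic_ker {k b : ℕ} {E Q : Type u} [Group E] [Group Q]
    (hQ : HasVirtualCyclicCentralSeries k b Q) (f : E →* Q) (hs : Function.Surjective f)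
    (hc : f.ker ≤ Subgroup.center E) (hcyc : IsCyclic f.ker) :
    HasVirtualCyclicCentralSeries (k + 1) b E := by
  obtain ⟨N, hN, h0, hi⟩ := hQ
  rw [← Subgroup.index_comap_of_surjective N hs] at h0 hi
  have hmem : ∀ x : N.comap f, x ∈ (f.subgroupComap N).ker → (x : E) ∈ f.ker :=
    fun x hx => congrArg Subtype.val hx
  refine ⟨N.comap f, ⟨N, _, f.subgroupComap N, fun x hx => ?_, ?_, hN⟩, h0, hi⟩
  · rw [Subgroup.mem_center_iff]
    exact fun a => Subtype.ext (Subgroup.mem_center_iff.1 (hc (hmem x hx)) a)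
  · let φ : (f.subgroupComap N).ker →* f.ker :=
      ((N.comap f).subtype.comp (Subgroup.subtype _)).codRestrict _ (fun x => hmem x x.2)
    refine isCyclic_of_injective φ fun a b hab => ?_
    have h := congrArg Subtype.val hab
    exact Subtype.ext (Subtype.ext h)

theorem of_finite_ker {k b M : ℕ} {E Q : Type u} [Group E] [Group Q]
    (hQ : HasVirtualCyclicCentralSeries k b Q) (f : E →* Q) (hs : Function.Surjective f)
    [Finite f.ker] (hM : Nat.card f.ker ≤ M) :
    HasVirtualCyclicCentralSeries k (M ^ (k + 1) * b) E := by
  obtain ⟨N, hN, h0, hi⟩ := hQ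
  rw [← Subgroup.index_comap_of_surjective N hs] at h0 hi
  let φ : (f.subgroupComap N).ker → f.ker := fun x => ⟨x, congrArg Subtype.val x.2⟩
  have hφ : Function.Injective φ := fun a b hab => by
    have h := congrArg Subtype.val hab
    exact Subtype.ext (Subtype.ext h)
  have : Finite (f.subgroupComap N).ker := Finite.of_injective φ hφ
  obtain ⟨N₁, hN₁, h10, h1i⟩ := hN.exists_subgroup_of_finite_ker (f.subgroupComap N)
    ((Nat.card_le_card_of_injective φ hφ).trans hM)
  refine ⟨N₁.map (N.comap f).subtype, hN₁.of_injective
      (N₁.equivMapOfInjective _ (Subgroup.subtype_injective _)).symm.toMonoidHom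
      (MulEquiv.injective _), ?_, ?_⟩
  · rw [Subgroup.index_map_subtype]
    exact mul_ne_zero h10 h0
  · rw [Subgroup.index_map_subtype]
    exact Nat.mul_le_mul h1i hi

/-- Passage from `G ⧸ K` to `G ⧸ L` when `K / L` is central and cyclic. -/
theorem quotient_of_central_cyclic {k b : ℕ} {G : Type u} [Group G] {L K : Subgroup G} [L.Normal]
    [K.Normal] (hLK : L ≤ K) (hc : ∀ g : G, ∀ x ∈ K, ⁅g, x⁆ ∈ L) (z : G)
    (hz : K ≤ L ⊔ Subgroup.zpowers z) (h : HasVirtualCyclicCentralSeries k b (G ⧸ K)) :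
    HasVirtualCyclicCentralSeries (k + 1) b (G ⧸ L) := by
  have hker := QuotientGroup.ker_map L K (MonoidHom.id G) hLK
  rw [Subgroup.comap_id] at hker
  refine h.of_central_cyclic_ker (QuotientGroup.map L K (MonoidHom.id G) hLK)
    (QuotientGroup.map_surjective_of_surjective _ _ _ (QuotientGroup.mk_surjective) _) ?_ ?_
  · rw [hker]
    rintro _ ⟨x, hx, rfl⟩
    rw [Subgroup.mem_center_iff]
    intro g
    obtain ⟨g, rfl⟩ := QuotientGroup.mk_surjective g
    rw [← commutatorElement_eq_one_iff_mul_comm]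
    exact (QuotientGroup.eq_one_iff _).2 (hc g x hx)
  · rw [hker]
    have hle : K.map (QuotientGroup.mk' L) ≤ Subgroup.zpowers (z : G ⧸ L) := by
      refine (Subgroup.map_mono hz).trans ?_
      rw [Subgroup.map_sup, MonoidHom.map_zpowers, QuotientGroup.map_mk'_self, bot_sup_eq]
      rfl
    exact isCyclic_of_injective (Subgroup.inclusion hle) (Subgroup.inclusion_injective hle)

/-- Passage from `G ⧸ K` to `G ⧸ L` when `K / L` has at most `M` elements. -/
theorem quotient_of_finite {k b M : ℕ} {G : Type u} [Group G] {L K : Subgroup G} [L.Normal]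
    [K.Normal] (hLK : L ≤ K) {T : Set G} (hT : T.Finite) (hM : T.ncard ≤ M)
    (hK : ∀ x ∈ K, ∃ t ∈ T, t⁻¹ * x ∈ L)
    (h : HasVirtualCyclicCentralSeries k b (G ⧸ K)) :
    HasVirtualCyclicCentralSeries k (M ^ (k + 1) * b) (G ⧸ L) := by
  have hker := QuotientGroup.ker_map L K (MonoidHom.id G) hLK
  rw [Subgroup.comap_id] at hker
  have hsub : ((QuotientGroup.map L K (MonoidHom.id G) hLK).ker : Set (G ⧸ L)) ⊆
      (QuotientGroup.mk '' T) := by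
    rw [hker]
    rintro _ ⟨x, hx, rfl⟩
    obtain ⟨t, ht, htx⟩ := hK x hx
    exact ⟨t, ht, QuotientGroup.eq.2 htx⟩
  have : Finite (QuotientGroup.map L K (MonoidHom.id G) hLK).ker :=
    ((hT.image _).subset hsub).to_subtype
  refine h.of_finite_ker (QuotientGroup.map L K (MonoidHom.id G) hLK)
    (QuotientGroup.map_surjective_of_surjective _ _ _ (QuotientGroup.mk_surjective) _) ?_
  exact (Set.ncard_le_ncard hsub (hT.image _)).trans ((Set.ncard_image_le hT).trans hM)

end HasVirtualCyclicCentralSeries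

/-! ### Product sets and the chain of stages -/

theorem Subgroup.list_prod_set_subset {G : Type*} [Group G] {S : List (Set G)} {K : Subgroup G}
    (h : ∀ s ∈ S, s ⊆ K) : S.prod ⊆ K := by
  induction S with
  | nil => simp
  | cons s S ih =>
    rw [List.prod_cons]
    rintro _ ⟨a, ha, b, hb, rfl⟩
    exact K.mul_mem (h s (by simp) ha) (ih (fun t ht => h t (by simp [ht])) hb)

theorem Set.one_mem_list_prod {G : Type*} [Monoid G] {S : List (Set G)}
    (h : ∀ s ∈ S, (1 : G) ∈ s) : (1 : G) ∈ S.prod := by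
  induction S with
  | nil => simp
  | cons s S ih =>
    rw [List.prod_cons]
    exact ⟨1, h s (by simp), 1, ih fun t ht => h t (by simp [ht]), one_mul 1⟩

theorem Set.subset_list_prod {G : Type*} [Monoid G] {S : List (Set G)}
    (h : ∀ s ∈ S, (1 : G) ∈ s) {s : Set G} (hs : s ∈ S) : s ⊆ S.prod := by
  induction S with
  | nil => simp at hs
  | cons t S ih =>
    rw [List.prod_cons]
    have hS : ∀ s ∈ S, (1 : G) ∈ s := fun s hs => h s (by simp [hs])
    rcases List.mem_cons.1 hs with rfl | hs
    · exact fun x hx => ⟨x, hx, 1, Set.one_mem_list_prod hS, mul_one x⟩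
    · exact fun x hx => ⟨1, h t (by simp), x, ih hS hs hx, one_mul x⟩

theorem Set.Finite.list_prod {G : Type*} [Monoid G] {S : List (Set G)}
    (h : ∀ s ∈ S, s.Finite) : S.prod.Finite := by
  induction S with
  | nil => simp
  | cons s S ih =>
    rw [List.prod_cons]
    exact (h s (by simp)).mul (ih fun t ht => h t (by simp [ht]))

namespace CosetNilData

variable {G : Type u} [Group G] {l : ℕ} {r : Fin l → ℕ} (D : CosetNilData.{u, v} G l r)

/-- The subgroup generated by the blocks of level at least `k`. -/
def upper (k : ℕ) : Subgroup G :=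
  Subgroup.closure {x | ∃ (i : Fin l) (j : Fin (r i + 1)), k ≤ (i : ℕ) ∧ x ∈ D.block i j}

/-- The subgroup generated by the first `k` blocks of level `i` and all blocks of higher level. -/
def stage (i : Fin l) (k : ℕ) : Subgroup G :=
  Subgroup.closure {x | ∃ (i' : Fin l) (j : Fin (r i' + 1)), (i < i' ∨ i' = i ∧ (j : ℕ) < k) ∧
    x ∈ D.block i' j}

variable {D}

theorem block_subset_upper {i : Fin l} {j : Fin (r i + 1)} {k : ℕ} (h : k ≤ i) :
    D.block i j ⊆ D.upper k :=
  fun _ hx => Subgroup.subset_closure ⟨i, j, h, hx⟩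

theorem block_subset_stage {i : Fin l} {j : Fin (r i + 1)} {k : ℕ} (h : (j : ℕ) < k) :
    D.block i j ⊆ D.stage i k :=
  fun _ hx => Subgroup.subset_closure ⟨i, j, Or.inr ⟨rfl, h⟩, hx⟩

theorem stage_mono {i : Fin l} {k m : ℕ} (h : k ≤ m) : D.stage i k ≤ D.stage i m :=
  Subgroup.closure_mono fun _ ⟨i', j, hi, hx⟩ =>
    ⟨i', j, hi.imp_right fun hj => ⟨hj.1, hj.2.trans_le h⟩, hx⟩

/-- Together with `stage_top`, this joins the stages of consecutive levels into one chain. -/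
theorem stage_zero (i : Fin l) : D.stage i 0 = D.upper (i + 1) := by
  unfold stage upper
  congr 1
  ext x
  simp only [Nat.not_lt_zero, and_false, or_false]
  rfl

theorem stage_top (i : Fin l) : D.stage i (r i + 1) = D.upper i := by
  unfold stage upper
  congr 1
  ext x
  constructor
  · rintro ⟨i', j, h | ⟨rfl, -⟩, hx⟩
    · exact ⟨i', j, le_of_lt h, hx⟩
    · exact ⟨i', j, le_rfl, hx⟩
  · rintro ⟨i', j, h, hx⟩
    rcases h.lt_or_eq with h | h
    · exact ⟨i', j, Or.inl h, hx⟩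
    · obtain rfl : i' = i := Fin.ext h.symm
      exact ⟨i', j, Or.inr ⟨rfl, j.2⟩, hx⟩

theorem upper_succ_le_stage (i : Fin l) (k : ℕ) : D.upper (i + 1) ≤ D.stage i k :=
  stage_zero (D := D) i ▸ stage_mono (Nat.zero_le k)

theorem upper_eq_bot {k : ℕ} (h : l ≤ k) : D.upper k = ⊥ := by
  rw [upper, Subgroup.closure_eq_bot_iff]
  rintro x ⟨i, j, hi, -⟩
  exact absurd i.2 (by omega)

theorem stage_le_upper {i : Fin l} {k m : ℕ} (hm : m ≤ i) : D.stage i k ≤ D.upper m := by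
  rw [stage, Subgroup.closure_le]
  rintro x ⟨i', j, h | ⟨rfl, -⟩, hx⟩
  · exact block_subset_upper (hm.trans (le_of_lt h)) hx
  · exact block_subset_upper hm hx

theorem levelsFrom_subset (k : ℕ) : D.levelsFrom k ⊆ D.upper k := by
  refine Subgroup.list_prod_set_subset fun s hs => ?_
  obtain ⟨n, hn, rfl⟩ := List.mem_drop_iff_getElem.1 (List.mem_reverse.1 hs)
  rw [List.getElem_ofFn]
  refine Subgroup.list_prod_set_subset fun t ht => ?_
  obtain ⟨j, rfl⟩ := (List.mem_ofFn' _ _).1 ht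
  exact block_subset_upper (by simp)

theorem partialLevel_subset (i : Fin l) (k : ℕ) : D.partialLevel i k ⊆ D.stage i k := by
  refine Subgroup.list_prod_set_subset fun s hs => ?_
  obtain ⟨n, hn, rfl⟩ := List.mem_take_iff_getElem.1 hs
  rw [List.getElem_ofFn]
  exact block_subset_stage (by simp; omega)

theorem finite_block (i : Fin l) (j : Fin (r i + 1)) : (D.block i j).Finite := by
  refine Fin.cases ?_ (fun j => ?_) j
  · exact Set.finite_range _
  · exact (Set.finite_Icc _ _).image _

theorem finite_levelsFrom (k : ℕ) : (D.levelsFrom k).Finite := by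
  refine Set.Finite.list_prod fun s hs => ?_
  obtain ⟨i, rfl⟩ := (List.mem_ofFn' _ _).1 (List.mem_of_mem_drop (List.mem_reverse.1 hs))
  refine Set.Finite.list_prod fun t ht => ?_
  obtain ⟨j, rfl⟩ := (List.mem_ofFn' _ _).1 ht
  exact finite_block i j

end CosetNilData

/-! ### Normality and commutators along the chain -/

namespace CosetNilprogression

open CosetNilData

variable {G : Type u} [Group G] {l : ℕ} {r : Fin l → ℕ} (P : CosetNilprogression.{u, v} G l r)

theorem one_mem_block (i : Fin l) (j : Fin (r i + 1)) : (1 : G) ∈ P.block i j := by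
  refine Fin.cases ?_ (fun j => ?_) j
  · exact ⟨0, P.cosetMap_zero i⟩
  · exact ⟨0, by simp [interval], P.intervalMap_zero i j⟩

theorem one_mem_level (i : Fin l) : (1 : G) ∈ P.level i := by
  refine Set.one_mem_list_prod fun s hs => ?_
  obtain ⟨j, rfl⟩ := (List.mem_ofFn' _ _).1 hs
  exact P.one_mem_block i j

theorem one_mem_carrier : (1 : G) ∈ P.carrier := by
  refine Set.one_mem_list_prod fun s hs => ?_
  obtain ⟨i, rfl⟩ := (List.mem_ofFn' _ _).1 (List.mem_of_mem_drop (List.mem_reverse.1 hs))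
  exact P.one_mem_level i

theorem block_subset_carrier (i : Fin l) (j : Fin (r i + 1)) : P.block i j ⊆ P.carrier := by
  have h1 : P.block i j ⊆ P.level i := by
    refine Set.subset_list_prod (fun s hs => ?_) ((List.mem_ofFn' _ _).2 ⟨j, rfl⟩)
    obtain ⟨j, rfl⟩ := (List.mem_ofFn' _ _).1 hs
    exact P.one_mem_block i j
  refine h1.trans (Set.subset_list_prod (fun s hs => ?_) ?_)
  · obtain ⟨i, rfl⟩ := (List.mem_ofFn' _ _).1 (List.mem_of_mem_drop (List.mem_reverse.1 hs))
    exact P.one_mem_level i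
  · simp

theorem finite_carrier : P.carrier.Finite := finite_levelsFrom 0

theorem closure_carrier : Subgroup.closure P.carrier = P.upper 0 := by
  refine le_antisymm ((Subgroup.closure_le _).2 (levelsFrom_subset 0)) ?_
  refine Subgroup.closure_mono ?_
  rintro x ⟨i, j, -, hx⟩
  exact P.block_subset_carrier i j hx

theorem cosetMap_mul_eq (i : Fin l) (n n' : P.H i) :
    ∃ a ∈ P.upper (i + 1), P.cosetMap i n * P.cosetMap i n' = a * P.cosetMap i (n + n') := by
  obtain ⟨a, ha, b, rfl, h⟩ := P.cosetMap_mul i n n'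
  exact ⟨a, levelsFrom_subset _ ha, h.symm⟩

theorem intervalMap_mul_eq (i : Fin l) (j : Fin (r i)) {n n' : ℤ} (hn : n ∈ P.interval i j)
    (hn' : n' ∈ P.interval i j) (h : n + n' ∈ P.interval i j) :
    ∃ a ∈ P.upper (i + 1),
      P.intervalMap i j n * P.intervalMap i j n' = a * P.intervalMap i j (n + n') := by
  obtain ⟨a, ha, b, rfl, h⟩ := P.intervalMap_mul i j n hn n' hn' h
  exact ⟨a, levelsFrom_subset _ ha, h.symm⟩

/-- Blocks need not be closed under inverses; the value at `-n` inverts the value at `n` modulo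
higher levels. -/
theorem exists_mul_mem_upper {i : Fin l} {j : Fin (r i + 1)} {x : G} (hx : x ∈ P.block i j) :
    ∃ y ∈ P.block i j, x * y ∈ P.upper (i + 1) := by
  induction j using Fin.cases with
  | zero =>
    obtain ⟨n, rfl⟩ := hx
    obtain ⟨a, ha, h⟩ := P.cosetMap_mul_eq i n (-n)
    refine ⟨P.cosetMap i (-n), ⟨_, rfl⟩, ?_⟩
    rwa [h, add_neg_cancel, P.cosetMap_zero, mul_one]
  | succ j =>
    obtain ⟨n, hn, rfl⟩ := hx
    have hn' : -n ∈ P.interval i j :=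
      ⟨neg_le_neg hn.2, neg_le.1 hn.1⟩
    obtain ⟨a, ha, h⟩ := P.intervalMap_mul_eq i j hn hn' (by simp [interval])
    refine ⟨P.intervalMap i j (-n), ⟨_, hn', rfl⟩, ?_⟩
    rwa [h, add_neg_cancel, P.intervalMap_zero, mul_one]

/-- With truncated subtraction, `(j - 1) + 1` is `j` for `j ≥ 1` but 1 for `j = 0`: the finite block
is only normalized, not centralized. If `x` has the higher level, the inverse commutator already
lies in higher levels than `i`. -/
theorem commutator_mem_stage {i' i : Fin l} {j' : Fin (r i' + 1)} {j : Fin (r i + 1)} {x y : G}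
    (hx : x ∈ P.block i' j') (hy : y ∈ P.block i j) :
    ⁅x, y⁆ ∈ P.stage i (((j : ℕ) - 1) + 1) := by
  have key : ∀ {i' i : Fin l} {j' : Fin (r i' + 1)} {j : Fin (r i + 1)} {x y : G}, i' < i →
      x ∈ P.block i' j' → y ∈ P.block i j → ⁅x, y⁆ ∈ P.stage i (((j : ℕ) - 1) + 1) := by
    intro i' i j' j x y hlt hx hy
    obtain ⟨a, ha, b, hb, h⟩ := P.commutator_lower_level i' i hlt j j' x hx y hy
    rw [← h]
    exact mul_mem (upper_succ_le_stage _ _ (levelsFrom_subset _ ha)) (partialLevel_subset _ _ hb)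
  rcases lt_trichotomy i' i with h | rfl | h
  · exact key h hx hy
  · exact upper_succ_le_stage _ _ (levelsFrom_subset _ (P.commutator_same_level _ _ _ x hx y hy))
  · rw [← commutatorElement_inv]
    exact inv_mem (upper_succ_le_stage _ _ (stage_le_upper h (key h hy hx)))

/-- For infinite `K`, conjugation could map `K` properly into itself, so inverses need care. With `x
* x'` in higher levels, `x⁻¹ = x' * (x * x')⁻¹`, and descending induction on the level handles the
second factor. -/
theorem upper_le_normalizer {K : Subgroup G}
    (hK : ∀ i j, ∀ x ∈ P.block i j, ∀ y ∈ K, x * y * x⁻¹ ∈ K) (k : ℕ) :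
    P.upper k ≤ Subgroup.normalizer (K : Set G) := by
  obtain ⟨n, hn⟩ : ∃ n, l ≤ k + n := ⟨l, by omega⟩
  induction n generalizing k with
  | zero => simp [upper_eq_bot (D := P.toCosetNilData) (show l ≤ k by omega)]
  | succ n ih =>
    rw [upper, Subgroup.closure_le]
    rintro x ⟨i, j, hi, hx⟩
    rw [SetLike.mem_coe, Subgroup.mem_normalizer_iff]
    refine fun y => ⟨hK i j x hx y, fun h => ?_⟩
    obtain ⟨x', hx', ha⟩ := P.exists_mul_mem_upper hx
    have hN := (Subgroup.mem_normalizer_iff.1 (inv_mem (ih (i + 1) (by omega) ha)) _).1 h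
    convert hK i j x' hx' _ hN using 1
    group

end CosetNilprogression

/-- Identities such as `⁅x, y * z⁆ = ⁅x, y⁆ * (y * ⁅x, z⁆ * y⁻¹)` extend the relation from
generators, first in the second variable, then in the first. -/
theorem Subgroup.commutator_mem_of_closure {G : Type*} [Group G] {S T : Set G} {K : Subgroup G}
    (hN : ∀ g ∈ closure S, ∀ x ∈ K, g * x * g⁻¹ ∈ K) (hT : closure T ≤ closure S)
    (h : ∀ x ∈ S, ∀ y ∈ T, ⁅x, y⁆ ∈ K) {g y : G} (hg : g ∈ closure S) (hy : y ∈ closure T) :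
    ⁅g, y⁆ ∈ K := by
  have hright : ∀ x ∈ S, ∀ y ∈ closure T, ⁅x, y⁆ ∈ K := by
    intro x hx y hy
    induction hy using closure_induction with
    | mem y hy => exact h x hx y hy
    | one => simp
    | mul y z hy _ ihy ihz =>
      convert mul_mem ihy (hN y (hT hy) _ ihz) using 1
      simp only [commutatorElement_def]
      group
    | inv y hy ihy =>
      convert hN y⁻¹ (inv_mem (hT hy)) _ (inv_mem ihy) using 1
      simp only [commutatorElement_def]
      group
  induction hg using closure_induction with
  | mem x hx => exact hright x hx y hy
  | one => simp
  | mul g h hg _ ihg ihh =>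
    convert mul_mem (hN g hg _ ihh) ihg using 1
    simp only [commutatorElement_def]
    group
  | inv g hg ihg =>
    convert hN g⁻¹ (inv_mem hg) _ (inv_mem ihg) using 1
    simp only [commutatorElement_def]
    group

namespace CosetNilprogression

open CosetNilData

variable {G : Type u} [Group G] {l : ℕ} {r : Fin l → ℕ} (P : CosetNilprogression.{u, v} G l r)

theorem commutator_mem_stage_pred {i' i : Fin l} {j' : Fin (r i' + 1)} {k : ℕ} {x y : G}
    (hx : x ∈ P.block i' j')
    (hy : ∃ (i₁ : Fin l) (j : Fin (r i₁ + 1)), (i < i₁ ∨ i₁ = i ∧ (j : ℕ) < k + 2) ∧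
      y ∈ P.block i₁ j) : ⁅x, y⁆ ∈ P.stage i (k + 1) := by
  obtain ⟨i₁, j, h | ⟨rfl, hj⟩, hy⟩ := hy
  · exact upper_succ_le_stage _ _ (stage_le_upper h (P.commutator_mem_stage hx hy))
  · exact stage_mono (by omega) (P.commutator_mem_stage hx hy)

theorem upper_le_normalizer_stage (i : Fin l) (k : ℕ) :
    P.upper 0 ≤ Subgroup.normalizer (P.stage i k : Set G) := by
  refine P.upper_le_normalizer (fun i' j' x hx y hy => ?_) 0
  have hgen : ∀ y ∈ {y | ∃ (i₁ : Fin l) (j : Fin (r i₁ + 1)),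
      (i < i₁ ∨ i₁ = i ∧ (j : ℕ) < k) ∧ y ∈ P.block i₁ j}, x * y * x⁻¹ ∈ P.stage i k := by
    intro y hy
    have hmem : y ∈ P.stage i k := Subgroup.subset_closure hy
    have hcomm : ⁅x, y⁆ ∈ P.stage i k := by
      obtain ⟨i₁, j, h | ⟨rfl, hj⟩, hy'⟩ := hy
      · exact upper_succ_le_stage _ _ (stage_le_upper h (P.commutator_mem_stage hx hy'))
      · exact stage_mono (by omega) (P.commutator_mem_stage hx hy')
    simpa [commutatorElement_def] using mul_mem hcomm hmem
  have hle : P.stage i k ≤ (P.stage i k).comap (MulAut.conj x).toMonoidHom :=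
    (Subgroup.closure_le _).2 hgen
  exact hle hy

theorem normal_stage (i : Fin l) (k : ℕ) : ((P.stage i k).subgroupOf (P.upper 0)).Normal :=
  Subgroup.normal_subgroupOf_of_le_normalizer (P.upper_le_normalizer_stage i k)

/-- This is the centrality of the factor coming from an interval block; the shift by 2 excludes the
finite block. -/
theorem commutator_mem_of_mem_upper {i : Fin l} {k : ℕ} {g y : G} (hg : g ∈ P.upper 0)
    (hy : y ∈ P.stage i (k + 2)) : ⁅g, y⁆ ∈ P.stage i (k + 1) := by
  have hN : ∀ g ∈ P.upper 0, ∀ x ∈ P.stage i (k + 1), g * x * g⁻¹ ∈ P.stage i (k + 1) :=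
    fun g hg x hx => (Subgroup.mem_normalizer_iff.1 (P.upper_le_normalizer_stage i _ hg) x).1 hx
  exact Subgroup.commutator_mem_of_closure hN (stage_le_upper (Nat.zero_le _))
    (fun x ⟨_, _, _, hx⟩ y hy => P.commutator_mem_stage_pred hx hy) hg hy

/-- An element generating `φ_{i,j}(H_{i,j})` modulo the higher levels. -/
theorem exists_block_succ_subset (i : Fin l) (j : Fin (r i)) :
    ∃ z ∈ P.block i j.succ, P.block i j.succ ⊆ (P.upper (i + 1) ⊔ Subgroup.zpowers z :) := by
  -- If `N i j = 0`, then 1 is outside the interval and `intervalMap i j 1` is unconstrained.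
  rcases Nat.eq_zero_or_pos (P.N i j) with h0 | hpos
  · refine ⟨1, P.one_mem_block i j.succ, ?_⟩
    rintro _ ⟨n, hn, rfl⟩
    obtain rfl : n = 0 := by
      simpa [interval, h0] using hn
    rw [P.intervalMap_zero]
    exact one_mem _
  · have h1 : (1 : ℤ) ∈ P.interval i j := by
      simp only [interval, Set.mem_Icc]
      omega
    refine ⟨P.intervalMap i j 1, ⟨1, h1, rfl⟩, ?_⟩
    set J := P.upper (i + 1) ⊔ Subgroup.zpowers (P.intervalMap i j 1) with hJ
    have hU : P.upper (i + 1) ≤ J := le_sup_left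
    have hz : P.intervalMap i j 1 ∈ J :=
      (le_sup_right : Subgroup.zpowers _ ≤ J) (Subgroup.mem_zpowers _)
    have hnat : ∀ n : ℕ, n ≤ P.N i j → P.intervalMap i j n ∈ J := by
      intro n
      induction n with
      | zero =>
        intro _
        rw [Nat.cast_zero, P.intervalMap_zero]
        exact one_mem _
      | succ n ih =>
        intro hn
        obtain ⟨a, ha, h⟩ := P.intervalMap_mul_eq i j (n := n) (n' := 1)
          (by simp only [interval, Set.mem_Icc]; omega) h1
          (by simp only [interval, Set.mem_Icc]; omega)
        rw [Nat.cast_succ, ← mul_mem_cancel_left (hU ha), ← h]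
        exact mul_mem (ih (by omega)) hz
    rintro _ ⟨n, hn, rfl⟩
    replace hn : n ∈ P.interval i j := hn
    simp only [interval, Set.mem_Icc] at hn
    obtain ⟨m, rfl | rfl⟩ := n.eq_nat_or_neg
    · exact hnat m (by omega)
    · obtain ⟨a, ha, h⟩ := P.intervalMap_mul_eq i j (n := m) (n' := -m)
        (by simp only [interval, Set.mem_Icc]; omega)
        (by simp only [interval, Set.mem_Icc]; omega)
        (by simp [interval])
      rw [add_neg_cancel, P.intervalMap_zero, mul_one] at h
      rw [SetLike.mem_coe, ← mul_mem_cancel_left (hnat m (by omega)), h]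
      exact hU ha

theorem exists_stage_succ_le (i : Fin l) (j : Fin (r i)) :
    ∃ z ∈ P.upper 0, P.stage i (j + 2) ≤ P.stage i (j + 1) ⊔ Subgroup.zpowers z := by
  obtain ⟨z, hz, hsub⟩ := P.exists_block_succ_subset i j
  refine ⟨z, block_subset_upper (Nat.zero_le _) hz, ?_⟩
  rw [stage, Subgroup.closure_le]
  have hU : P.upper (i + 1) ≤ P.stage i (j + 1) := upper_succ_le_stage _ _
  rintro x ⟨i', j', h | ⟨rfl, hj⟩, hx⟩
  · exact (hU.trans le_sup_left) (block_subset_upper h hx)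
  · rcases Nat.lt_succ_iff_lt_or_eq.1 hj with hj | hj
    · exact (le_sup_left : _ ≤ P.stage i' (j + 1) ⊔ _) (block_subset_stage hj hx)
    · obtain rfl : j' = j.succ := Fin.ext hj
      exact (sup_le_sup_right hU _) (hsub hx)

theorem cosetMap_mem_block (i : Fin l) (n : P.H i) : P.cosetMap i n ∈ P.block i 0 :=
  ⟨n, rfl⟩

/-- Modulo higher levels `cosetMap i` is a homomorphism, so its image is already a subgroup and
represents every coset. -/
theorem exists_cosetMap_inv_mul_mem {i : Fin l} {x : G} (hx : x ∈ P.stage i 1) :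
    ∃ t ∈ P.block i 0, t⁻¹ * x ∈ P.stage i 0 := by
  have := P.normal_stage i 0
  have hU : ∀ n, P.cosetMap i n ∈ P.upper 0 := fun n =>
    block_subset_upper (Nat.zero_le _) (P.cosetMap_mem_block i n)
  let ψ : Multiplicative (P.H i) →* P.upper 0 ⧸ (P.stage i 0).subgroupOf (P.upper 0) :=
    MonoidHom.mk' (fun n => ((⟨P.cosetMap i n.toAdd, hU _⟩ : P.upper 0) : _ ⧸ _)) (by
      intro m n
      obtain ⟨a, ha, h⟩ := P.cosetMap_mul_eq i m.toAdd n.toAdd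
      rw [← stage_zero] at ha
      rw [← QuotientGroup.mk_mul, eq_comm, QuotientGroup.eq_iff_div_mem, Subgroup.mem_subgroupOf]
      simp [div_eq_mul_inv, h, ha])
  have hle : P.stage i 1 ≤ (ψ.range.comap (QuotientGroup.mk' _)).map (P.upper 0).subtype := by
    rw [stage, Subgroup.closure_le]
    rintro x ⟨i', j', h | ⟨rfl, hj⟩, hx⟩
    · refine ⟨⟨x, block_subset_upper (Nat.zero_le _) hx⟩, ⟨1, ?_⟩, rfl⟩
      rw [map_one, eq_comm]
      refine (QuotientGroup.eq_one_iff _).2 ?_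
      rw [Subgroup.mem_subgroupOf, stage_zero]
      exact block_subset_upper h hx
    · obtain rfl : j' = 0 := Fin.ext (by simpa using hj)
      obtain ⟨n, rfl⟩ := hx
      exact ⟨⟨_, hU n⟩, ⟨Multiplicative.ofAdd n, rfl⟩, rfl⟩
  obtain ⟨y, ⟨n, hn⟩, rfl⟩ := hle hx
  exact ⟨_, P.cosetMap_mem_block i n.toAdd, Subgroup.mem_subgroupOf.1 (QuotientGroup.eq.1 hn)⟩

/-! ### Building up the quotients of ⟨A⟩ -/

/-- The quotient of `⟨A⟩` by `K` has a subgroup of index at most `b` with a central series with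
`k` cyclic factors. -/
def QuotientHasVirtualSeries (k b : ℕ) (K : Subgroup G) : Prop :=
  ∃ _ : (K.subgroupOf (P.upper 0)).Normal,
    HasVirtualCyclicCentralSeries k b (P.upper 0 ⧸ K.subgroupOf (P.upper 0))

theorem quotientHasVirtualSeries_stage_succ {k b : ℕ} (i : Fin l) (j : Fin (r i))
    (h : P.QuotientHasVirtualSeries k b (P.stage i (j + 2))) :
    P.QuotientHasVirtualSeries (k + 1) b (P.stage i (j + 1)) := by
  obtain ⟨_, h⟩ := h
  have := P.normal_stage i (j + 1)
  obtain ⟨z, hzU, hz⟩ := P.exists_stage_succ_le i j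
  refine ⟨this, h.quotient_of_central_cyclic ?_ ?_ ⟨z, hzU⟩ ?_⟩
  · exact Subgroup.comap_mono (stage_mono (by omega))
  · exact fun g x hx => P.commutator_mem_of_mem_upper g.2 hx
  · rw [← Subgroup.map_subtype_le_map_subtype, Subgroup.map_sup, MonoidHom.map_zpowers,
      Subgroup.map_subgroupOf_eq_of_le (stage_le_upper (Nat.zero_le _)),
      Subgroup.map_subgroupOf_eq_of_le (stage_le_upper (Nat.zero_le _))]
    exact hz

theorem quotientHasVirtualSeries_stage_zero {k b M : ℕ} (i : Fin l)
    (hM : (P.block i 0).ncard ≤ M)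
    (h : P.QuotientHasVirtualSeries k b (P.stage i 1)) :
    P.QuotientHasVirtualSeries k (M ^ (k + 1) * b) (P.stage i 0) := by
  obtain ⟨_, h⟩ := h
  have := P.normal_stage i 0
  refine ⟨this, h.quotient_of_finite ?_
    (T := (P.upper 0).subtype ⁻¹' P.block i 0)
    ((finite_block i 0).preimage (Subtype.val_injective.injOn)) ?_ ?_⟩
  · exact Subgroup.comap_mono (stage_mono (by omega))
  · refine le_trans ?_ hM
    rw [← Set.ncard_image_of_injective _ (P.upper 0).subtype_injective]
    exact Set.ncard_le_ncard (Set.image_preimage_subset _ _) (finite_block i 0)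
  · intro x hx
    obtain ⟨t, ht, h⟩ := P.exists_cosetMap_inv_mul_mem hx
    exact ⟨⟨t, block_subset_upper (Nat.zero_le _) ht⟩, ht, h⟩

theorem quotientHasVirtualSeries_upper_succ {k b M : ℕ} (i : Fin l)
    (hM : (P.block i 0).ncard ≤ M) (h : P.QuotientHasVirtualSeries k b (P.upper i)) :
    P.QuotientHasVirtualSeries (k + r i) (M ^ (k + r i + 1) * b) (P.upper (i + 1)) := by
  rw [← stage_zero]
  refine P.quotientHasVirtualSeries_stage_zero i hM ?_
  -- After `t` interval blocks are removed from the top, `r i - t` of them and the finite block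
  -- remain.
  have key : ∀ t ≤ r i, P.QuotientHasVirtualSeries (k + t) b (P.stage i (r i - t + 1)) := by
    intro t
    induction t with
    | zero =>
      intro _
      rw [Nat.sub_zero, stage_top]
      exact h
    | succ t ih =>
      intro ht
      refine P.quotientHasVirtualSeries_stage_succ i ⟨r i - (t + 1), by omega⟩ ?_
      have := ih (by omega)
      rwa [show r i - t + 1 = r i - (t + 1) + 2 by omega] at this
  simpa using key (r i) le_rfl

theorem quotientHasVirtualSeries_upper {M R : ℕ} (hM0 : 1 ≤ M)
    (hM : ∀ i, (P.block i 0).ncard ≤ M) (hR : ∀ i, r i ≤ R) (n : ℕ) (hn : n ≤ l) :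
    P.QuotientHasVirtualSeries (n * R) (M ^ (n * (l * R + 1))) (P.upper n) := by
  induction n with
  | zero =>
    have htop : (P.upper 0).subgroupOf (P.upper 0) = ⊤ := Subgroup.subgroupOf_self _
    have hN : ((P.upper 0).subgroupOf (P.upper 0)).Normal := htop ▸ inferInstance
    refine ⟨hN, ⊤, ?_, by simp, by simp⟩
    have hs : Subsingleton (P.upper 0 ⧸ (P.upper 0).subgroupOf (P.upper 0)) :=
      QuotientGroup.subsingleton_iff.2 htop
    rw [Nat.zero_mul]
    exact Subsingleton.intro fun a b => Subtype.ext (Subsingleton.elim _ _)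
  | succ n ih =>
    obtain ⟨hN, h⟩ := P.quotientHasVirtualSeries_upper_succ ⟨n, hn⟩ (hM _) (ih (by omega))
    have hr := hR ⟨n, hn⟩
    have hk : n * R + r ⟨n, hn⟩ ≤ (n + 1) * R := by rw [Nat.succ_mul]; omega
    refine ⟨hN, h.mono hk ?_⟩
    -- Each level adds at most `l * R + 1` to the exponent, since the series never exceeds length `l
    -- * R`.
    rw [← pow_add, Nat.succ_mul, Nat.add_comm (n * _)]
    have hl : (n + 1) * R ≤ l * R := Nat.mul_le_mul_right R hn
    exact Nat.pow_le_pow_right hM0 (by omega)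

theorem hasVirtualCyclicCentralSeries {M R : ℕ} (hM0 : 1 ≤ M)
    (hM : ∀ i, (P.block i 0).ncard ≤ M) (hR : ∀ i, r i ≤ R) :
    HasVirtualCyclicCentralSeries (l * R) (M ^ (l * (l * R + 1)))
      (Subgroup.closure P.carrier) := by
  obtain ⟨hN, h⟩ := P.quotientHasVirtualSeries_upper hM0 hM hR l le_rfl
  rw [P.closure_carrier]
  refine h.of_injective_surjective (QuotientGroup.mk' _) ?_ (QuotientGroup.mk'_surjective _)
  rw [← MonoidHom.ker_eq_bot_iff, QuotientGroup.ker_mk', upper_eq_bot le_rfl,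
    Subgroup.bot_subgroupOf]

end CosetNilprogression

/-! ### The uniform constant -/

theorem mainTheorem7 (l : ℕ) (r : Fin l → ℕ) :
    ∃ C : ℕ, ∀ (G : Type u) [Group G] (P : CosetNilprogression.{u, v} G l r),
      (∃ N : Subgroup (Subgroup.closure P.carrier),
        N.FiniteIndex ∧ N.index ≤ C * P.carrier.ncard ^ C ∧
          IsNilpotentOfStepLE N C ∧ IsGeneratedByLE N C) ∧
      (P.IsNilprogression →
        IsNilpotentOfStepLE (Subgroup.closure P.carrier) C ∧
          IsGeneratedByLE (Subgroup.closure P.carrier) C) := by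
  set R := ∑ i, r i with hRdef
  have hR : ∀ i, r i ≤ R := fun i =>
    Finset.single_le_sum (f := r) (fun _ _ => Nat.zero_le _) (Finset.mem_univ i)
  have hC : l * R ≤ l * (l * R + 1) + 1 := by
    rcases Nat.eq_zero_or_pos l with rfl | hl
    · simp
    · nlinarith [Nat.mul_le_mul_right (l * R) hl]
  -- One more than the index exponent: this keeps the factor `C` positive and exceeds the series
  -- length `l * R`.
  refine ⟨l * (l * R + 1) + 1, fun G _ P => ⟨?_, fun hP => ?_⟩⟩
  · have hpos : 1 ≤ P.carrier.ncard :=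
      (Set.ncard_pos P.finite_carrier).2 ⟨1, P.one_mem_carrier⟩
    obtain ⟨N, hN, h0, hi⟩ := P.hasVirtualCyclicCentralSeries hpos
      (fun i => Set.ncard_le_ncard (P.block_subset_carrier i 0) P.finite_carrier) hR
    refine ⟨N, ⟨h0⟩, hi.trans ?_, (hN.mono hC).isNilpotentOfStepLE, (hN.mono hC).isGeneratedByLE⟩
    exact (Nat.pow_le_pow_right hpos (Nat.le_succ _)).trans (Nat.le_mul_of_pos_left _ (by omega))
  · have hblock : ∀ i, (P.block i 0).ncard ≤ 1 := by
      intro i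
      have hsub : P.block i 0 ⊆ {1} := by
        rintro _ ⟨h, rfl⟩
        exact (hP i).2 h
      simpa using Set.ncard_le_ncard hsub
    obtain ⟨N, hN, h0, hi⟩ := P.hasVirtualCyclicCentralSeries le_rfl hblock hR
    -- With `M = 1` the index bound is `1 ^ _ = 1`.
    have htop : N = ⊤ := Subgroup.index_eq_one.1 (by rw [one_pow] at hi; omega)
    subst htop
    have h : HasCyclicCentralSeries (l * R) (Subgroup.closure P.carrier) :=
      hN.of_injective Subgroup.topEquiv.symm.toMonoidHom (MulEquiv.injective _)
    exact ⟨(h.mono hC).isNilpotentOfStepLE, (h.mono hC).isGeneratedByLE⟩
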